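/- \textbf{Setting.} An approval profile over a finite set $C$ of candidates is a finite sequence of ballots $A_1,\dots,A_n\subseteq C$. Satisfaction Approval Voting (SAV) with committee size $k$ elects the set $W\subseteq C$ with $|W|=k$ that maximizes \[ \mathrm{Sat}(W)=\sum_{i=1}^{n}\frac{|W\cap A_i|}{|A_i|} \] (an empty ballot contributes $0$). Ties are broken by a given linear priority order $\succ$ on $C$, extended lexicographically: among the maximizing sets of size $k$, $W$ is preferred to $W'$ if the $\succ$-highest candidate in the symmetric difference of $W$ and $W'$ belongs to $W$. \textbf{Problem} (Winning Set Manipulation for SAV with two agents still to vote). Input: a finite set $C$ of candidates, ballots $A_1,\dots,A_n\subseteq C$, a committee size $k\in\mathbb{N}$, a set $P\subseteq C$ and a linear order $\succ$ on $C$. Question: are there two additional ballots $B_1,B_2\subseteq C$ such that $P$ is the winning set of size $k$ under SAV for the profile $A_1,\dots,A_n,B_1,B_2$ with tie-breaking order $\succ$? \textbf{Theorem.} This problem is solvable in polynomial time: there are an algorithm and a polynomial $T$ such that on every input the algorithm answers the question correctly within $T(s)$ steps, where $s$ is the bit size of the input (numbers are written in binary, sets of candidates as $0/1$-vectors indexed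 by $C$, the order as the list of the positions of the candidates). Here $k$ is part of the input and is not bounded by a constant. Steps are counted on a random access machine under the logarithmic cost criterion, which is polynomially equivalent to counting steps of a Turing machine. -/

import Mathlib

/-! ## Random access machines with logarithmic cost

A memory is a function `M : ℕ → ℕ` (register `i` holds the natural number `M i`). Programs are
structured random access machine programs (no recursion, no unbounded data in the program text).
Running time is measured by the logarithmic cost criterion: each number that is read, computed,
stored or used as an address is charged its number of binary digits, plus one per operation. Up to
polynomials this is the running time of Turing machines. -/

/-- Expressions: constants, indirect addressing, and the operations `+`, `-` (truncated at `0`)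
and `*` on natural numbers. -/
inductive RamExpr : Type
  | lit (n : ℕ)
  | load (a : RamExpr)
  | add (a b : RamExpr)
  | sub (a b : RamExpr)
  | mul (a b : RamExpr)

namespace RamExpr

/-- The value of an expression in the memory `M`; `load a` is the content of the register whose
address is the value of `a`. -/
def eval (M : ℕ → ℕ) : RamExpr → ℕ
  | lit n => n
  | load a => M (a.eval M)
  | add a b => a.eval M + b.eval M
  | sub a b => a.eval M - b.eval M
  | mul a b => a.eval M * b.eval M

/-- The logarithmic cost of evaluating an expression: every node of the expression tree is charged
one plus the number of binary digits of its value. -/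
def cost (M : ℕ → ℕ) : RamExpr → ℕ
  | lit n => Nat.size n + 1
  | load a => a.cost M + Nat.size (M (a.eval M)) + 1
  | add a b => a.cost M + b.cost M + Nat.size (a.eval M + b.eval M) + 1
  | sub a b => a.cost M + b.cost M + Nat.size (a.eval M - b.eval M) + 1
  | mul a b => a.cost M + b.cost M + Nat.size (a.eval M * b.eval M) + 1

end RamExpr

/-- Programs: do nothing; store the value of `e` in the register with address (the value of) `a`;
sequential composition; branch on `e ≠ 0`; repeat while `e ≠ 0`. -/
inductive RamProg : Type
  | skip
  | store (a e : RamExpr)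
  | seq (p q : RamProg)
  | ite (e : RamExpr) (p q : RamProg)
  | loop (e : RamExpr) (p : RamProg)

/-- `RamExec p M M' t`: started in the memory `M`, the program `p` halts with memory `M'`
at total logarithmic cost `t`. -/
inductive RamExec : RamProg → (ℕ → ℕ) → (ℕ → ℕ) → ℕ → Prop
  | skip (M : ℕ → ℕ) : RamExec RamProg.skip M M 1
  | store (a e : RamExpr) (M : ℕ → ℕ) :
      RamExec (RamProg.store a e) M (Function.update M (a.eval M) (e.eval M))
        (a.cost M + e.cost M + 1)
  | seq {p q : RamProg} {M M' M'' : ℕ → ℕ} {t t' : ℕ} :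
      RamExec p M M' t → RamExec q M' M'' t' → RamExec (RamProg.seq p q) M M'' (t + t' + 1)
  | ite_true {e : RamExpr} {p q : RamProg} {M M' : ℕ → ℕ} {t : ℕ} :
      e.eval M ≠ 0 → RamExec p M M' t → RamExec (RamProg.ite e p q) M M' (e.cost M + t + 1)
  | ite_false {e : RamExpr} {p q : RamProg} {M M' : ℕ → ℕ} {t : ℕ} :
      e.eval M = 0 → RamExec q M M' t → RamExec (RamProg.ite e p q) M M' (e.cost M + t + 1)
  | loop_done {e : RamExpr} {p : RamProg} {M : ℕ → ℕ} :
      e.eval M = 0 → RamExec (RamProg.loop e p) M M (e.cost M + 1)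
  | loop_step {e : RamExpr} {p : RamProg} {M M' M'' : ℕ → ℕ} {t t' : ℕ} :
      e.eval M ≠ 0 → RamExec p M M' t → RamExec (RamProg.loop e p) M' M'' t' →
      RamExec (RamProg.loop e p) M M'' (e.cost M + t + t' + 1)

/-- The initial memory on the input `l`: register `0` holds the length of `l`, the registers
`1, 2, …` hold the entries of `l`, and all other registers hold `0`. -/
def ramInput (l : List ℕ) : ℕ → ℕ :=
  fun i => (l.length :: l).getD i 0

/-- The size in bits of an input that is a list of natural numbers written in binary (with one
delimiter for each entry). -/
def ramInputSize (l : List ℕ) : ℕ :=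
  (l.map fun a => Nat.size a + 1).sum

/-- The decision problem `Q` on instances in `α`, which are encoded by `enc`, is solvable in
polynomial time: a single program halts on all instances within a time that is polynomial in the
bit size of the encoded instance, and answers (in register `0`) `1` if `Q` holds and `0` if not. -/
def PolyTimeDecidable {α : Type} (enc : α → List ℕ) (Q : α → Prop) : Prop :=
  ∃ (p : RamProg) (T : Polynomial ℕ), ∀ x : α, ∃ (M : ℕ → ℕ) (t : ℕ),
    RamExec p (ramInput (enc x)) M t ∧ t ≤ T.eval (ramInputSize (enc x)) ∧
      (Q x → M 0 = 1) ∧ (¬ Q x → M 0 = 0)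

/-! ## Approval-based multi-winner rules -/

/-- An approval-based multi-winner rule: for `m` candidates, approval ballots `A 0, …, A (n - 1)`,
a committee size `k` and a tie-breaking order `tie` (candidate `c` has priority over candidate `d`
if `tie c < tie d`), the statement that the set `W` is the winning set. -/
def ApprovalRule : Type :=
  ∀ m n : ℕ, (Fin n → Finset (Fin m)) → ℕ → Equiv.Perm (Fin m) → Finset (Fin m) → Prop

/-- The total satisfaction `∑ i, |W ∩ A i| / |A i|`; an empty ballot contributes `0`. -/
def satisfaction {m n : ℕ} (A : Fin n → Finset (Fin m)) (W : Finset (Fin m)) : ℚ :=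
  ∑ i, ((W ∩ A i).card : ℚ) / ((A i).card : ℚ)

/-- The lexicographic extension of the priority order to sets of equal size: `W` is preferred to
`W'` if the candidate of highest priority on which they differ belongs to `W`. -/
def LexPreferred {m : ℕ} (tie : Equiv.Perm (Fin m)) (W W' : Finset (Fin m)) : Prop :=
  ∃ c ∈ W \ W', ∀ d ∈ W' \ W, tie c < tie d

/-- Satisfaction Approval Voting: the winning set is the set of size `k` of maximum total
satisfaction, ties between such sets being broken lexicographically. -/
def SAV : ApprovalRule := fun _ _ A k tie W =>
  W.card = k ∧ ∀ W' : Finset _, W'.card = k → W' ≠ W →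
    satisfaction A W' < satisfaction A W ∨
      (satisfaction A W' = satisfaction A W ∧ LexPreferred tie W W')

/-- The input of Winning Set Manipulation, apart from the rule and the number of agents still to
vote: `m` candidates, `n` approval ballots already cast, the committee size `k`, the set `P` of
preferred candidates, and the tie-breaking order. -/
structure WSMInstance : Type where
  m : ℕ
  n : ℕ
  ballots : Fin n → Finset (Fin m)
  k : ℕ
  P : Finset (Fin m)
  tie : Equiv.Perm (Fin m)

/-- The indicator vector of a set of candidates. -/
def indicatorList {m : ℕ} (S : Finset (Fin m)) : List ℕ :=
  List.ofFn fun c : Fin m => if c ∈ S then 1 else 0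

/-- An instance as a list of numbers: `m`, `n`, `k`, the indicator vector of `P`, the position of
each candidate in the tie-breaking order, and the indicator vectors of the ballots. -/
def WSMInstance.encode (I : WSMInstance) : List ℕ :=
  [I.m, I.n, I.k] ++ indicatorList I.P ++ (List.ofFn fun c : Fin I.m => (I.tie c : ℕ)) ++
    (List.ofFn fun i : Fin I.n => indicatorList (I.ballots i)).flatten

/-- Winning Set Manipulation for the rule `R` with `j` agents still to vote: are there `j`
additional approval ballots such that `P` is the winning set under `R`? -/
def WinningSetManipulation (R : ApprovalRule) (j : ℕ) (I : WSMInstance) : Prop :=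
  ∃ B : Fin j → Finset (Fin I.m), R I.m (I.n + j) (Fin.append I.ballots B) I.k I.tie I.P

/-! Fix the sizes a, b ≤ m of the two new ballots; only (m+1)² pairs occur. A vote on a ballot of
size j is worth 1/j, so multiplying by m! makes every score a natural number (`natScore`), and the
tie-breaking position, appended as a low-order digit, turns the order of the rule into the order of
integers (`WSMInstance.key`). Satisfaction is additive over candidates, so P wins exactly if it has
size k and every member has a larger key than every outsider (`sav_iff`,
`WSMInstance.sav_append_iff`).

This condition couples pairs of candidates. Guessing the smallest key θ attained in P decouples it:
members need a key at least θ, outsiders a key below θ. Since θ is the key of some member of P under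
one of four membership patterns, there are few guesses. Now each candidate restricts only its own
two membership bits, upward monotonically for members and downward for outsiders. Whether two sets
of prescribed sizes meet such local constraints is settled by a few counting inequalities
(`exists_pair_of_card_iff`), so no ballots have to be searched.

The resulting criterion (`WSMInstance.winningSetManipulation_sav_iff`) is one fixed arithmetic term
built from sums, products and quantifiers over ranges bounded by the input length. Its intermediate
values have polynomially many bits (`BTerm.exists_eval_le`), and nested loops evaluate it in
polynomial time (`BTerm.exists_computesTo_compile`, `polyTimeDecidable_of_term`). -/

/-! ## Arithmetic terms with bounded folds -/

/-- The arithmetic operations of the machine. -/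
inductive ArithOp : Type
  | add
  | sub
  | mul

namespace ArithOp

/-- The operation on natural numbers. -/
def apply : ArithOp → ℕ → ℕ → ℕ
  | add, a, b => a + b
  | sub, a, b => a - b
  | mul, a, b => a * b

/-- The operation on expressions. -/
def expr : ArithOp → RamExpr → RamExpr → RamExpr
  | add => RamExpr.add
  | sub => RamExpr.sub
  | mul => RamExpr.mul

theorem eval_expr (o : ArithOp) (M : ℕ → ℕ) (a b : RamExpr) :
    (o.expr a b).eval M = o.apply (a.eval M) (b.eval M) := by
  cases o <;> rfl

theorem cost_expr (o : ArithOp) (M : ℕ → ℕ) (a b : RamExpr) :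
    (o.expr a b).cost M =
      a.cost M + b.cost M + Nat.size (o.apply (a.eval M) (b.eval M)) + 1 := by
  cases o <;> rfl

/-- Both powers are at least 1, so twice their product dominates the sum as well as the product; one
exponent serves all three operations. -/
theorem apply_le (o : ArithOp) {a b A B : ℕ} (ha : a ≤ 2 ^ A) (hb : b ≤ 2 ^ B) :
    o.apply a b ≤ 2 ^ (A + B + 1) := by
  have hA : 1 ≤ 2 ^ A := Nat.one_le_two_pow
  have hB : 1 ≤ 2 ^ B := Nat.one_le_two_pow
  have h : (2 : ℕ) ^ (A + B + 1) = 2 * (2 ^ A * 2 ^ B) := by ring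
  rw [h]
  cases o <;> simp only [apply]
  · nlinarith
  · have := Nat.sub_le a b
    nlinarith
  · have := Nat.mul_le_mul ha hb
    omega

/-- Left fold of the operation over `f 0, …, f (n - 1)`. -/
def fold (o : ArithOp) (init : ℕ) (f : ℕ → ℕ) : ℕ → ℕ
  | 0 => init
  | n + 1 => o.apply (fold o init f n) (f n)

theorem fold_le (o : ArithOp) {init : ℕ} {f : ℕ → ℕ} {S : ℕ} (n : ℕ)
    (hf : ∀ i < n, f i ≤ 2 ^ S) : o.fold init f n ≤ 2 ^ (init + n * (S + 1)) := by
  induction n with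
  | zero => simpa [fold] using Nat.lt_two_pow_self.le
  | succ n ih =>
    refine (o.apply_le (ih fun i hi => hf i (by omega)) (hf n (by omega))).trans_eq ?_
    ring

theorem fold_add (f : ℕ → ℕ) (n : ℕ) : add.fold 0 f n = ∑ i ∈ Finset.range n, f i := by
  induction n with
  | zero => rfl
  | succ n ih => rw [Finset.sum_range_succ, ← ih]; rfl

theorem fold_mul (f : ℕ → ℕ) (n : ℕ) : mul.fold 1 f n = ∏ i ∈ Finset.range n, f i := by
  induction n with
  | zero => rfl
  | succ n ih => rw [Finset.prod_range_succ, ← ih]; rfl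

end ArithOp

/-- Terms over the input list: constants, variables, entries of the initial memory, arithmetic
operations, and folds in which a variable runs over the numbers below the length of the input. -/
inductive BTerm : Type
  | lit (n : ℕ)
  | var (x : ℕ)
  | input (t : BTerm)
  | bin (o : ArithOp) (s t : BTerm)
  | big (o : ArithOp) (init : ℕ) (x : ℕ) (t : BTerm)

namespace BTerm

/-- The value of a term on the input `l` when the variables have the values `ρ`. -/
def eval (l : List ℕ) : BTerm → (ℕ → ℕ) → ℕ
  | lit n, _ => n
  | var x, ρ => ρ x
  | input t, ρ => ramInput l (t.eval l ρ)
  | bin o s t, ρ => o.apply (s.eval l ρ) (t.eval l ρ)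
  | big o init x t, ρ => o.fold init (fun i => t.eval l (Function.update ρ x i)) l.length

end BTerm

/-! ### Sizes -/

theorem size_le_self (a : ℕ) : Nat.size a ≤ a :=
  Nat.size_le.2 Nat.lt_two_pow_self

theorem size_le_succ_of_le_two_pow {a S : ℕ} (h : a ≤ 2 ^ S) : Nat.size a ≤ S + 1 :=
  Nat.size_le.2 (h.trans_lt (Nat.pow_lt_pow_right (by norm_num) (by omega)))

theorem length_le_ramInputSize (l : List ℕ) : l.length ≤ ramInputSize l := by
  induction l with
  | nil => simp
  | cons a l ih =>
    simp only [ramInputSize, List.map_cons, List.sum_cons, List.length_cons] at *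
    omega

theorem ramInput_le (l : List ℕ) (i : ℕ) : ramInput l i ≤ 2 ^ ramInputSize l := by
  have key : ∀ (l : List ℕ) (j : ℕ), l.getD j 0 ≤ 2 ^ ramInputSize l := by
    intro l
    induction l with
    | nil => intro j; simp
    | cons a l ih =>
      intro j
      have hs : ramInputSize (a :: l) = Nat.size a + 1 + ramInputSize l := by
        simp [ramInputSize]
      rw [hs]
      cases j with
      | zero =>
        have := (Nat.lt_size_self a).le
        simp only [List.getD_cons_zero]
        exact this.trans (Nat.pow_le_pow_right (by norm_num) (by omega))
      | succ j =>
        simp only [List.getD_cons_succ]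
        exact (ih j).trans (Nat.pow_le_pow_right (by norm_num) (by omega))
  cases i with
  | zero =>
    simp only [ramInput, List.getD_cons_zero]
    exact (length_le_ramInputSize l).trans Nat.lt_two_pow_self.le
  | succ i => simpa only [ramInput, List.getD_cons_succ] using key l i

/-- The body of a fold sees the index but not the accumulated value, so even in an iterated product
the bit lengths add up instead of multiplying. Each nesting level costs one factor of the input
length, and the nesting depth of a given term is fixed. -/
theorem BTerm.exists_eval_le (t : BTerm) : ∃ S : Polynomial ℕ, ∀ (l : List ℕ) (ρ : ℕ → ℕ),
    (∀ x, ρ x ≤ l.length) → t.eval l ρ ≤ 2 ^ S.eval (ramInputSize l) := by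
  induction t with
  | lit n =>
    refine ⟨Polynomial.C n, fun l ρ _ => ?_⟩
    simpa [eval] using Nat.lt_two_pow_self.le
  | var x =>
    refine ⟨Polynomial.X, fun l ρ h => ?_⟩
    simpa [eval] using (h x).trans ((length_le_ramInputSize l).trans Nat.lt_two_pow_self.le)
  | input t _ =>
    exact ⟨Polynomial.X, fun l ρ _ => by simpa [eval] using ramInput_le l _⟩
  | bin o s t hs ht =>
    obtain ⟨S, hS⟩ := hs
    obtain ⟨T, hT⟩ := ht
    refine ⟨S + T + 1, fun l ρ h => ?_⟩
    simpa [eval] using o.apply_le (hS l ρ h) (hT l ρ h)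
  | big o init x t ht =>
    obtain ⟨S, hS⟩ := ht
    refine ⟨Polynomial.C init + Polynomial.X * (S + 1), fun l ρ h => ?_⟩
    have := o.fold_le (init := init) (f := fun i => t.eval l (Function.update ρ x i)) l.length
      (S := S.eval (ramInputSize l)) fun i hi => hS l _ fun y => by
        by_cases hy : y = x
        · subst hy; simpa using hi.le
        · simpa [hy] using h y
    refine this.trans (Nat.pow_le_pow_right (by norm_num) ?_)
    simp only [Polynomial.eval_add, Polynomial.eval_mul, Polynomial.eval_C, Polynomial.eval_X,
      Polynomial.eval_one]
    gcongr
    exact length_le_ramInputSize l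

/-! ### Compilation to the random access machine -/

/-- The address of the `j`-th working register, behind the input. -/
def regAddr (j : ℕ) : RamExpr :=
  .add (.load (.lit 0)) (.lit (j + 1))

/-- The content of the `j`-th working register. -/
def regLoad (j : ℕ) : RamExpr :=
  .load (regAddr j)

theorem eval_regAddr {M : ℕ → ℕ} {n : ℕ} (h : M 0 = n) (j : ℕ) :
    (regAddr j).eval M = n + (j + 1) := by
  simp [regAddr, RamExpr.eval, h]

theorem eval_regLoad {M : ℕ → ℕ} {n : ℕ} (h : M 0 = n) (j : ℕ) :
    (regLoad j).eval M = M (n + (j + 1)) := by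
  simp [regLoad, regAddr, RamExpr.eval, h]

theorem cost_regAddr_le {M : ℕ → ℕ} {s : ℕ} (h : M 0 ≤ s) (j : ℕ) :
    (regAddr j).cost M ≤ 2 * s + 2 * j + 6 := by
  have h1 := size_le_self (M 0)
  have h2 := size_le_self (j + 1)
  have h3 := size_le_self (M 0 + (j + 1))
  simp only [regAddr, RamExpr.cost, RamExpr.eval, Nat.size_zero]
  omega

theorem cost_regLoad_le {M : ℕ → ℕ} {s : ℕ} (h : M 0 ≤ s) (j : ℕ) :
    (regLoad j).cost M ≤ 2 * s + 2 * j + 7 + Nat.size (M (M 0 + (j + 1))) := by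
  have h1 := cost_regAddr_le h j
  simp only [regLoad, RamExpr.cost]
  rw [eval_regAddr rfl]
  omega

namespace BTerm

/-- A program that writes the value of the term to the working register `2 * r + 1`; the variable
`x` is kept in the working register `2 * x`. -/
def compile : BTerm → ℕ → RamProg
  | lit n, r => .store (regAddr (2 * r + 1)) (.lit n)
  | var x, r => .store (regAddr (2 * r + 1)) (regLoad (2 * x))
  | input t, r => .seq (t.compile r)
      (.ite (.sub (regLoad (2 * r + 1)) (.load (.lit 0)))
        (.store (regAddr (2 * r + 1)) (.lit 0))
        (.store (regAddr (2 * r + 1)) (.load (regLoad (2 * r + 1)))))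
  | bin o s t, r => .seq (s.compile r) (.seq (t.compile (r + 1))
      (.store (regAddr (2 * r + 1)) (o.expr (regLoad (2 * r + 1)) (regLoad (2 * (r + 1) + 1)))))
  | big o init x t, r =>
      .seq (.store (regAddr (2 * r + 1)) (.lit init))
      (.seq (.store (regAddr (2 * (r + 1) + 1)) (regLoad (2 * x)))
      (.seq (.store (regAddr (2 * x)) (.lit 0))
      (.seq (.loop (.sub (.load (.lit 0)) (regLoad (2 * x)))
        (.seq (t.compile (r + 2))
        (.seq (.store (regAddr (2 * r + 1))
          (o.expr (regLoad (2 * r + 1)) (regLoad (2 * (r + 2) + 1))))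
        (.store (regAddr (2 * x)) (.add (regLoad (2 * x)) (.lit 1))))))
      (.store (regAddr (2 * x)) (regLoad (2 * (r + 1) + 1))))))

/-- The memory holds the input `l` and the values `ρ` of the variables. -/
structure Represents (l : List ℕ) (ρ M : ℕ → ℕ) : Prop where
  input : ∀ i ≤ l.length, M i = ramInput l i
  vars : ∀ x, M (l.length + (2 * x + 1)) = ρ x

/-- The memories agree outside the temporary registers with number at least `r`. -/
def AgreeBelow (l : List ℕ) (r : ℕ) (M M' : ℕ → ℕ) : Prop :=
  ∀ i, (∀ j, r ≤ j → i ≠ l.length + (2 * j + 1 + 1)) → M' i = M i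

theorem Represents.zero {l : List ℕ} {ρ M : ℕ → ℕ} (h : Represents l ρ M) : M 0 = l.length := by
  rw [h.input 0 (Nat.zero_le _)]; rfl

theorem Represents.of_agreeBelow {l : List ℕ} {ρ M M' : ℕ → ℕ} {r : ℕ} (h : Represents l ρ M)
    (h' : AgreeBelow l r M M') : Represents l ρ M' where
  input i hi := by rw [h' i fun j _ => by omega, h.input i hi]
  vars x := by rw [h' _ fun j _ => by omega, h.vars x]

theorem agreeBelow_update (l : List ℕ) (M : ℕ → ℕ) (r v : ℕ) :
    AgreeBelow l r M (Function.update M (l.length + (2 * r + 1 + 1)) v) := fun i hi => by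
  rw [Function.update_of_ne (hi r le_rfl)]

/-- The program `p` computes the value `v` to the temporary register `r`, at cost at most `T`. -/
def ComputesTo (p : RamProg) (l : List ℕ) (M : ℕ → ℕ) (r v T : ℕ) : Prop :=
  ∃ (M' : ℕ → ℕ) (c : ℕ), RamExec p M M' c ∧ c ≤ T ∧ M' (l.length + (2 * r + 1 + 1)) = v ∧
    AgreeBelow l r M M'

theorem ComputesTo.mono {p : RamProg} {l : List ℕ} {M : ℕ → ℕ} {r v T T' : ℕ}
    (h : ComputesTo p l M r v T) (hT : T ≤ T') : ComputesTo p l M r v T' := by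
  obtain ⟨M', c, h1, h2, h3⟩ := h
  exact ⟨M', c, h1, h2.trans hT, h3⟩

theorem exec_store {l : List ℕ} {ρ M : ℕ → ℕ} (hM : Represents l ρ M) (j : ℕ) (e : RamExpr) :
    ∃ c, RamExec (.store (regAddr j) e) M (Function.update M (l.length + (j + 1)) (e.eval M)) c ∧
      c ≤ 2 * ramInputSize l + 2 * j + 7 + e.cost M := by
  have h := cost_regAddr_le (hM.zero.trans_le (length_le_ramInputSize l)) j
  have := RamExec.store (regAddr j) e M
  rw [eval_regAddr hM.zero] at this
  exact ⟨_, this, by omega⟩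

theorem computesTo_store {l : List ℕ} {ρ M : ℕ → ℕ} (hM : Represents l ρ M) (r : ℕ)
    (e : RamExpr) :
    ComputesTo (.store (regAddr (2 * r + 1)) e) l M r (e.eval M)
      (2 * ramInputSize l + 4 * r + 9 + e.cost M) := by
  obtain ⟨c, h, hc⟩ := exec_store hM (2 * r + 1) e
  exact ⟨_, c, h, by omega, Function.update_self .., agreeBelow_update l M r _⟩

theorem ComputesTo.seq {p q : RamProg} {l : List ℕ} {ρ M : ℕ → ℕ} {r r' v w T T' : ℕ}
    (hM : Represents l ρ M) (h : ComputesTo p l M r v T)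
    (hq : ∀ M', Represents l ρ M' → M' (l.length + (2 * r + 1 + 1)) = v →
      AgreeBelow l r M M' → ComputesTo q l M' r' w T') (hr : r' ≤ r) :
    ComputesTo (.seq p q) l M r' w (T + T' + 1) := by
  obtain ⟨M', c, h1, h2, h3, h4⟩ := h
  obtain ⟨M'', c', h1', h2', h3', h4'⟩ := hq M' (hM.of_agreeBelow h4) h3 h4
  refine ⟨M'', _, .seq h1 h1', by omega, h3', fun i hi => ?_⟩
  rw [h4' i hi, h4 i fun j hj => hi j (hr.trans hj)]

/-- Induction on the number `d` of remaining rounds, with the accumulator holding the fold of the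
first `i` values. Accumulator and summand have at most `F + 1` bits, so a round costs `C` for the
body plus a linear overhead; the factor 100 is merely generous. -/
theorem exec_big_loop {l : List ℕ} {ρ : ℕ → ℕ} {f : ℕ → ℕ} {o : ArithOp} {init x r C F : ℕ}
    {p : RamProg} (hf : ∀ i < l.length, f i ≤ 2 ^ F)
    (hF : ∀ i ≤ l.length, o.fold init f i ≤ 2 ^ F)
    (hp : ∀ M, ∀ i < l.length, Represents l (Function.update ρ x i) M →
      ComputesTo p l M (r + 2) (f i) C) (d : ℕ) :
    ∀ i M, i + d = l.length → Represents l (Function.update ρ x i) M →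
      M (l.length + (2 * r + 1 + 1)) = o.fold init f i →
      ∃ (M' : ℕ → ℕ) (c : ℕ), RamExec (.loop (.sub (.load (.lit 0)) (regLoad (2 * x)))
        (.seq p (.seq (.store (regAddr (2 * r + 1))
          (o.expr (regLoad (2 * r + 1)) (regLoad (2 * (r + 2) + 1))))
        (.store (regAddr (2 * x)) (.add (regLoad (2 * x)) (.lit 1)))))) M M' c ∧
        c ≤ d * (C + 100 * (ramInputSize l + r + x + F + 1)) +
          100 * (ramInputSize l + r + x + F + 1) ∧
        M' (l.length + (2 * r + 1 + 1)) = o.fold init f l.length ∧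
        ∀ a, a ≠ l.length + (2 * x + 1) → a ≠ l.length + (2 * r + 1 + 1) →
          (∀ j, r + 2 ≤ j → a ≠ l.length + (2 * j + 1 + 1)) → M' a = M a := by
  have hls := length_le_ramInputSize l
  have guard : ∀ i M, i ≤ l.length → Represents l (Function.update ρ x i) M →
      (RamExpr.sub (.load (.lit 0)) (regLoad (2 * x))).eval M = l.length - i ∧
      (RamExpr.sub (.load (.lit 0)) (regLoad (2 * x))).cost M ≤
        5 * ramInputSize l + 4 * x + 11 := by
    intro i M hi hM
    have hx : M (l.length + (2 * x + 1)) = i := by rw [hM.vars, Function.update_self]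
    have h1 := cost_regLoad_le (hM.zero.trans_le hls) (2 * x)
    rw [hM.zero, hx] at h1
    have h2 := size_le_self i
    have h3 := size_le_self l.length
    have h4 := size_le_self (l.length - i)
    simp only [RamExpr.eval, RamExpr.cost, eval_regLoad hM.zero, hM.zero, hx, Nat.size_zero]
    exact ⟨trivial, by omega⟩
  induction d with
  | zero =>
    intro i M hi hM hr
    obtain ⟨g1, g2⟩ := guard i M (by omega) hM
    refine ⟨M, _, .loop_done (by omega), by omega, ?_, fun _ _ _ _ => rfl⟩
    rw [hr, ← hi, Nat.add_zero]
  | succ d ih =>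
    intro i M hi hM hr
    obtain ⟨g1, g2⟩ := guard i M (by omega) hM
    obtain ⟨M₁, c₁, e₁, hc₁, hv₁, ha₁⟩ := hp M i (by omega) hM
    have hM₁ := hM.of_agreeBelow ha₁
    have hr₁ : M₁ (l.length + (2 * r + 1 + 1)) = o.fold init f i := by
      rw [ha₁ _ fun j hj => by omega, hr]
    obtain ⟨c₂, e₂, hc₂⟩ :=
      exec_store hM₁ (2 * r + 1) (o.expr (regLoad (2 * r + 1)) (regLoad (2 * (r + 2) + 1)))
    rw [o.eval_expr, eval_regLoad hM₁.zero, eval_regLoad hM₁.zero, hr₁, hv₁] at e₂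
    set M₂ := Function.update M₁ (l.length + (2 * r + 1 + 1)) (o.apply (o.fold init f i) (f i))
      with hM₂_def
    have hv₂ : M₂ (l.length + (2 * r + 1 + 1)) = _ := Function.update_self ..
    have ha₂ : AgreeBelow l r M₁ M₂ := agreeBelow_update l M₁ r _
    have hM₂ := hM₁.of_agreeBelow ha₂
    have hx₂ : M₂ (l.length + (2 * x + 1)) = i := by rw [hM₂.vars, Function.update_self]
    obtain ⟨c₃, e₃, hc₃⟩ := exec_store hM₂ (2 * x) (.add (regLoad (2 * x)) (.lit 1))
    simp only [RamExpr.eval, eval_regLoad hM₂.zero, hx₂] at e₃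
    set M₃ := Function.update M₂ (l.length + (2 * x + 1)) (i + 1) with hM₃
    have hR₃ : Represents l (Function.update ρ x (i + 1)) M₃ := by
      constructor
      · intro a ha
        rw [hM₃, Function.update_of_ne (by omega), hM₂.input a ha]
      · intro y
        by_cases hy : y = x
        · subst hy; simp [hM₃]
        · rw [hM₃, Function.update_of_ne (by omega), hM₂.vars, Function.update_of_ne hy,
            Function.update_of_ne hy]
    obtain ⟨M₄, c₄, e₄, hc₄, hv₄, ha₄⟩ := ih (i + 1) M₃ (by omega) hR₃ (by
      rw [hM₃, Function.update_of_ne (by omega), hv₂]; rfl)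
    refine ⟨M₄, _, .loop_step (by omega) (.seq e₁ (.seq e₂ e₃)) e₄, ?_, hv₄, ?_⟩
    · have k1 := cost_regLoad_le (hM₁.zero.trans_le hls) (2 * r + 1)
      have k2 := cost_regLoad_le (hM₁.zero.trans_le hls) (2 * (r + 2) + 1)
      rw [hM₁.zero, hr₁] at k1
      rw [hM₁.zero, hv₁] at k2
      have s1 := size_le_succ_of_le_two_pow (hF i (by omega))
      have s2 := size_le_succ_of_le_two_pow (hf i (by omega))
      have s3 := size_le_succ_of_le_two_pow (hF (i + 1) (by omega))
      rw [ArithOp.fold] at s3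
      rw [o.cost_expr, eval_regLoad hM₁.zero, eval_regLoad hM₁.zero, hr₁, hv₁] at hc₂
      have k3 := cost_regLoad_le (hM₂.zero.trans_le hls) (2 * x)
      rw [hM₂.zero, hx₂] at k3
      have s4 := size_le_self i
      have s5 := size_le_self (i + 1)
      have s6 : Nat.size 1 = 1 := Nat.size_one
      rw [Nat.succ_mul d]
      simp only [RamExpr.cost, RamExpr.eval, eval_regLoad hM₂.zero, hx₂] at hc₃
      omega
    · intro a h1 h2 h3
      rw [ha₄ a h1 h2 h3, hM₃, Function.update_of_ne h1, hM₂_def, Function.update_of_ne h2,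
        ha₁ a h3]

/-- Later subterms are evaluated into higher temporaries, so the induction is uniform in `r`, and
`AgreeBelow` keeps results already stored at lower numbers intact. By `exists_eval_le` all register
contents are short, so every instruction is cheap. -/
theorem exists_computesTo_compile (t : BTerm) : ∀ r, ∃ T : Polynomial ℕ,
    ∀ (l : List ℕ) (ρ M : ℕ → ℕ), (∀ x, ρ x ≤ l.length) → Represents l ρ M →
      ComputesTo (t.compile r) l M r (t.eval l ρ) (T.eval (ramInputSize l)) := by
  induction t with
  | lit n =>
    intro r
    refine ⟨2 * .X + .C (4 * r + 10 + n), fun l ρ M _ hM => (computesTo_store hM r _).mono ?_⟩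
    have := size_le_self n
    simp [RamExpr.cost]
    omega
  | var x =>
    intro r
    refine ⟨5 * .X + .C (4 * r + 4 * x + 16), fun l ρ M hρ hM => ?_⟩
    have h := computesTo_store hM r (regLoad (2 * x))
    have hs := length_le_ramInputSize l
    have h1 := cost_regLoad_le (hM.zero.trans_le hs) (2 * x)
    rw [hM.zero, hM.vars] at h1
    rw [eval_regLoad hM.zero, hM.vars] at h
    refine h.mono ?_
    have := size_le_self (ρ x)
    have := hρ x
    simp
    omega
  | input t ih =>
    intro r
    obtain ⟨T, hT⟩ := ih r
    obtain ⟨S, hS⟩ := t.exists_eval_le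
    refine ⟨T + 15 * .X + 3 * S + .C (20 * r + 100), fun l ρ M hρ hM => ?_⟩
    have hs := length_le_ramInputSize l
    have hS := size_le_succ_of_le_two_pow (hS l ρ hρ)
    have hsi := size_le_succ_of_le_two_pow (ramInput_le l (t.eval l ρ))
    refine ((hT l ρ M hρ hM).seq (T' := 15 * ramInputSize l + 3 * S.eval (ramInputSize l) +
      (20 * r + 99)) hM (fun M' hM' hv _ => ?_) le_rfl).mono ?_
    · have hc := cost_regLoad_le (hM'.zero.trans_le hs) (2 * r + 1)
      rw [hM'.zero, hv] at hc
      have hl := size_le_self l.length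
      have hd : Nat.size (t.eval l ρ - l.length) ≤ Nat.size (t.eval l ρ) :=
        Nat.size_le_size (Nat.sub_le _ _)
      by_cases h : t.eval l ρ ≤ l.length
      · obtain ⟨M'', c, h1, h2, h3⟩ :=
          computesTo_store hM' r (.load (regLoad (2 * r + 1)))
        refine ⟨M'', _, .ite_false ?_ h1, ?_, ?_⟩
        · simp only [RamExpr.eval, eval_regLoad hM'.zero, hM'.zero, hv]
          omega
        · simp only [RamExpr.cost, RamExpr.eval, eval_regLoad hM'.zero, hM'.zero, hv,
            hM'.input _ h, Nat.size_zero] at h2 ⊢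
          omega
        · simp only [RamExpr.eval, eval_regLoad hM'.zero, hv, hM'.input _ h] at h3
          exact h3
      -- Addresses beyond the input hold working registers, so the default value 0 has to be written
      -- explicitly instead of loaded. The address `l.length` itself still belongs to the input.
      · have h0 : ramInput l (t.eval l ρ) = 0 :=
          List.getD_eq_default _ _ (by simp; omega)
        obtain ⟨M'', c, h1, h2, h3⟩ := computesTo_store hM' r (.lit 0)
        refine ⟨M'', _, .ite_true ?_ h1, ?_, ?_⟩
        · simp only [RamExpr.eval, eval_regLoad hM'.zero, hM'.zero, hv]
          omega
        · simp only [RamExpr.cost, RamExpr.eval, eval_regLoad hM'.zero, hM'.zero, hv,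
            Nat.size_zero] at h2 ⊢
          omega
        · simpa only [eval, h0, RamExpr.eval] using h3
    · simp
      omega
  | bin o s t hs ht =>
    intro r
    obtain ⟨T₁, hT₁⟩ := hs r
    obtain ⟨T₂, hT₂⟩ := ht (r + 1)
    obtain ⟨S₁, hS₁⟩ := s.exists_eval_le
    obtain ⟨S₂, hS₂⟩ := t.exists_eval_le
    refine ⟨T₁ + T₂ + 6 * .X + 2 * S₁ + 2 * S₂ + .C (20 * r + 100), fun l ρ M hρ hM => ?_⟩
    have hl := length_le_ramInputSize l
    have hS₁ := hS₁ l ρ hρ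
    have hS₂ := hS₂ l ρ hρ
    have hS₃ := size_le_succ_of_le_two_pow (o.apply_le hS₁ hS₂)
    have hS₁ := size_le_succ_of_le_two_pow hS₁
    have hS₂ := size_le_succ_of_le_two_pow hS₂
    refine ((hT₁ l ρ M hρ hM).seq (T' := T₂.eval (ramInputSize l) + (6 * ramInputSize l +
      2 * S₁.eval (ramInputSize l) + 2 * S₂.eval (ramInputSize l) + 20 * r + 98) + 1) hM
      (fun M' hM' hv _ => (hT₂ l ρ M' hρ hM').seq hM' (fun M'' hM'' hv' ha => ?_)
        (Nat.le_succ r)) le_rfl).mono ?_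
    · have h := computesTo_store hM'' r
        (o.expr (regLoad (2 * r + 1)) (regLoad (2 * (r + 1) + 1)))
      have hv'' : M'' (l.length + (2 * r + 1 + 1)) = s.eval l ρ := by
        rw [ha _ fun j hj => by omega, hv]
      have h1 := cost_regLoad_le (hM''.zero.trans_le hl) (2 * r + 1)
      have h2 := cost_regLoad_le (hM''.zero.trans_le hl) (2 * (r + 1) + 1)
      rw [hM''.zero, hv''] at h1
      rw [hM''.zero, hv'] at h2
      rw [o.eval_expr, o.cost_expr, eval_regLoad hM''.zero, eval_regLoad hM''.zero, hv', hv'']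
        at h
      refine h.mono ?_
      omega
    · simp
      omega
  | big o init x t ih =>
    intro r
    obtain ⟨T, hT⟩ := ih (r + 2)
    obtain ⟨S, hS⟩ := t.exists_eval_le
    -- `F` bounds the bits of the summands (through `S`) and of all partial folds (through the other
    -- two terms).
    obtain ⟨F, hF⟩ : ∃ F : Polynomial ℕ, F = S + .C init + .X * (S + 1) := ⟨_, rfl⟩
    obtain ⟨K, hK⟩ : ∃ K : Polynomial ℕ, K = 100 * (.X + .C r + .C x + F + 1) := ⟨_, rfl⟩
    refine ⟨.X * (T + K) + 3 * K + .C init, fun l ρ M hρ hM => ?_⟩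
    have hs := length_le_ramInputSize l
    have hFe : F.eval (ramInputSize l) = S.eval (ramInputSize l) + init +
        ramInputSize l * (S.eval (ramInputSize l) + 1) := by simp [hF]
    have hKe : K.eval (ramInputSize l) =
        100 * (ramInputSize l + r + x + F.eval (ramInputSize l) + 1) := by simp [hK]
    have hρ' : ∀ i ≤ l.length, ∀ y, Function.update ρ x i y ≤ l.length := fun i hi y => by
      by_cases hy : y = x
      · subst hy; simpa using hi
      · simpa [hy] using hρ y
    obtain ⟨f, hf⟩ : ∃ f : ℕ → ℕ, f = fun i => t.eval l (Function.update ρ x i) := ⟨_, rfl⟩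
    have hfS : ∀ i < l.length, f i ≤ 2 ^ S.eval (ramInputSize l) := fun i hi => by
      rw [hf]; exact hS l _ (hρ' i hi.le)
    obtain ⟨c₁, e₁, hc₁⟩ := exec_store hM (2 * r + 1) (.lit init)
    set M₁ := Function.update M (l.length + (2 * r + 1 + 1)) ((RamExpr.lit init).eval M) with hM₁
    have hR₁ : Represents l ρ M₁ := hM.of_agreeBelow (agreeBelow_update l M r _)
    obtain ⟨c₂, e₂, hc₂⟩ := exec_store hR₁ (2 * (r + 1) + 1) (regLoad (2 * x))
    have k₂ := cost_regLoad_le (hR₁.zero.trans_le hs) (2 * x)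
    rw [eval_regLoad hR₁.zero, hR₁.vars] at e₂
    rw [hR₁.zero, hR₁.vars] at k₂
    set M₂ := Function.update M₁ (l.length + (2 * (r + 1) + 1 + 1)) (ρ x) with hM₂
    have hR₂ : Represents l ρ M₂ := hR₁.of_agreeBelow (agreeBelow_update l M₁ (r + 1) _)
    obtain ⟨c₃, e₃, hc₃⟩ := exec_store hR₂ (2 * x) (.lit 0)
    set M₃ := Function.update M₂ (l.length + (2 * x + 1)) ((RamExpr.lit 0).eval M₂) with hM₃
    have hR₃ : Represents l (Function.update ρ x 0) M₃ := by
      constructor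
      · intro a ha
        rw [hM₃, Function.update_of_ne (by omega), hR₂.input a ha]
      · intro y
        by_cases hy : y = x
        · subst hy; simp [hM₃, RamExpr.eval]
        · rw [hM₃, Function.update_of_ne (by omega), hR₂.vars, Function.update_of_ne hy]
    obtain ⟨M₄, c₄, e₄, hc₄, hv₄, ha₄⟩ := exec_big_loop (o := o) (init := init) (x := x) (r := r)
      (ρ := ρ) (f := f) (p := t.compile (r + 2)) (C := T.eval (ramInputSize l))
      (F := F.eval (ramInputSize l))
      (fun i hi => (hfS i hi).trans (Nat.pow_le_pow_right (by norm_num) (by omega)))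
      (fun i hi => (o.fold_le i fun j hj => hfS j (by omega)).trans
        (Nat.pow_le_pow_right (by norm_num) (by
          rw [hFe]
          have : i * (S.eval (ramInputSize l) + 1) ≤
            ramInputSize l * (S.eval (ramInputSize l) + 1) :=
              Nat.mul_le_mul_right _ (hi.trans hs)
          omega)))
      (fun M' i hi hM' => by
        rw [hf]; exact hT l _ M' (hρ' i hi.le) hM')
      l.length 0 M₃ (by omega) hR₃ (by
        rw [hM₃, Function.update_of_ne (by omega), hM₂, Function.update_of_ne (by omega), hM₁,
          Function.update_self]; rfl)
    have hsave : M₄ (l.length + (2 * (r + 1) + 1 + 1)) = ρ x := by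
      rw [ha₄ _ (by omega) (by omega) fun j hj => by omega, hM₃,
        Function.update_of_ne (by omega), hM₂, Function.update_self]
    -- The final value of the loop variable is irrelevant: its old value was saved in temporary `r +
    -- 1`, which the body cannot touch, and is restored next. Hence a fold may rebind a variable
    -- already in use.
    have hR₄ : Represents l (Function.update ρ x (M₄ (l.length + (2 * x + 1)))) M₄ := by
      constructor
      · intro a ha
        rw [ha₄ a (by omega) (by omega) fun j _ => by omega, hR₃.input a ha]
      · intro y
        by_cases hy : y = x
        · subst hy; simp
        · rw [ha₄ _ (by omega) (by omega) fun j _ => by omega, hR₃.vars, Function.update_of_ne hy,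
            Function.update_of_ne hy]
    obtain ⟨c₅, e₅, hc₅⟩ := exec_store hR₄ (2 * x) (regLoad (2 * (r + 1) + 1))
    have k₅ := cost_regLoad_le (hR₄.zero.trans_le hs) (2 * (r + 1) + 1)
    rw [eval_regLoad hR₄.zero, hsave] at e₅
    rw [hR₄.zero, hsave] at k₅
    refine ⟨_, _, .seq e₁ (.seq e₂ (.seq e₃ (.seq e₄ e₅))), ?_, ?_, ?_⟩
    · have s1 := size_le_self init
      have s2 := size_le_self (ρ x)
      have s3 := hρ x
      have s4 : l.length * (T.eval (ramInputSize l) + K.eval (ramInputSize l)) ≤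
          ramInputSize l * (T.eval (ramInputSize l) + K.eval (ramInputSize l)) :=
        Nat.mul_le_mul_right _ hs
      rw [← hKe] at hc₄
      simp only [RamExpr.cost, Nat.size_zero] at hc₁ hc₃
      simp only [Polynomial.eval_add, Polynomial.eval_mul, Polynomial.eval_X, Polynomial.eval_C,
        Polynomial.eval_ofNat]
      omega
    · rw [Function.update_of_ne (by omega), hv₄, hf]; rfl
    · intro a ha
      by_cases hx : a = l.length + (2 * x + 1)
      · subst hx
        rw [Function.update_self, hM.vars]
      · rw [Function.update_of_ne hx, ha₄ a hx (ha r le_rfl) fun j hj => ha j (by omega), hM₃,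
          Function.update_of_ne hx, hM₂, Function.update_of_ne (ha (r + 1) (by omega)), hM₁,
          Function.update_of_ne (ha r le_rfl)]

end BTerm

/-- A problem that is expressed by a bounded arithmetic term in the encoded instance is solvable in
polynomial time. -/
theorem polyTimeDecidable_of_term {α : Type} {enc : α → List ℕ} {Q : α → Prop} (t : BTerm)
    (h1 : ∀ x, Q x → t.eval (enc x) 0 = 1) (h0 : ∀ x, ¬ Q x → t.eval (enc x) 0 = 0) :
    PolyTimeDecidable enc Q := by
  obtain ⟨T, hT⟩ := t.exists_computesTo_compile 0
  obtain ⟨S, hS⟩ := t.exists_eval_le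
  refine ⟨.seq (t.compile 0) (.store (.lit 0) (regLoad 1)), T + 2 * .X + S + 100, fun x => ?_⟩
  have hs := length_le_ramInputSize (enc x)
  -- Registers behind the input start at 0, so the initial memory already represents the zero
  -- assignment.
  have hM : BTerm.Represents (enc x) 0 (ramInput (enc x)) :=
    ⟨fun _ _ => rfl, fun y => List.getD_eq_default _ _ (by simp)⟩
  obtain ⟨M, c, e, hc, hv, ha⟩ := hT (enc x) 0 _ (fun _ => Nat.zero_le _) hM
  have hM' := hM.of_agreeBelow ha
  have hc' := cost_regLoad_le (hM'.zero.trans_le hs) 1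
  have hS := size_le_succ_of_le_two_pow (hS (enc x) 0 fun _ => Nat.zero_le _)
  rw [hM'.zero, hv] at hc'
  have e' := RamExec.store (.lit 0) (regLoad 1) M
  rw [eval_regLoad hM'.zero, hv] at e'
  refine ⟨_, _, .seq e e', ?_, fun hq => ?_, fun hq => ?_⟩
  · simp [RamExpr.cost]
    omega
  · simp [RamExpr.eval, h1 x hq]
  · simp [RamExpr.eval, h0 x hq]

/-! ## Winning sets of Satisfaction Approval Voting -/

/-- The satisfaction that the ballots give to a single candidate. -/
def candidateScore {m n : ℕ} (A : Fin n → Finset (Fin m)) (c : Fin m) : ℚ :=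
  ∑ i, if c ∈ A i then ((A i).card : ℚ)⁻¹ else 0

theorem satisfaction_eq_sum {m n : ℕ} (A : Fin n → Finset (Fin m)) (W : Finset (Fin m)) :
    satisfaction A W = ∑ c ∈ W, candidateScore A c := by
  simp only [satisfaction, candidateScore]
  rw [Finset.sum_comm]
  refine Finset.sum_congr rfl fun i _ => ?_
  rw [← Finset.sum_filter, Finset.filter_mem_eq_inter, Finset.sum_const, nsmul_eq_mul,
    div_eq_mul_inv]

/-- By additivity, optimality can be tested on single exchanges. Conversely, if no single exchange
helps, every candidate leaving `W` is at least as good as every candidate entering, and equally many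
leave and enter. -/
theorem sav_iff {m n : ℕ} (A : Fin n → Finset (Fin m)) (k : ℕ) (tie : Equiv.Perm (Fin m))
    (W : Finset (Fin m)) :
    SAV m n A k tie W ↔ W.card = k ∧ ∀ p ∈ W, ∀ q ∉ W,
      candidateScore A q < candidateScore A p ∨
        (candidateScore A q = candidateScore A p ∧ tie p < tie q) := by
  simp only [SAV, satisfaction_eq_sum]
  refine and_congr_right fun hk => ⟨fun h p hp q hq => ?_, fun h W' hW' hne => ?_⟩
  · have hqe : q ∉ W.erase p := fun h => hq (Finset.mem_of_mem_erase h)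
    have hpq : p ≠ q := fun h => hq (h ▸ hp)
    have hs : ∑ c ∈ insert q (W.erase p), candidateScore A c + candidateScore A p =
        ∑ c ∈ W, candidateScore A c + candidateScore A q := by
      rw [Finset.sum_insert hqe, ← Finset.sum_erase_add W _ hp]
      ring
    rcases h (insert q (W.erase p))
      (by rw [Finset.card_insert_of_notMem hqe, Finset.card_erase_add_one hp, hk])
      (fun e => hq (e ▸ Finset.mem_insert_self q _)) with h | ⟨h, c, hc, hd⟩
    · left; linarith
    · right
      refine ⟨by linarith, ?_⟩
      have hcp : c = p := by
        by_contra hcp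
        simp [hcp] at hc
        exact hc.2.2 hc.1
      subst hcp
      exact hd q (by simp [hq])
  · have hcard : (W \ W').card = (W' \ W).card := Finset.card_sdiff_comm (hk.trans hW'.symm)
    have hpos : (W' \ W).Nonempty := by
      rw [Finset.sdiff_nonempty]
      intro hsub
      exact hne (Finset.eq_of_subset_of_card_le hsub (hk.trans hW'.symm).le)
    have hpos' : (W \ W').Nonempty := by
      rwa [← Finset.card_pos, hcard, Finset.card_pos]
    have e := Finset.sum_sdiff_sub_sum_sdiff (s₁ := W) (s₂ := W') (f := candidateScore A)
    have hpq : ∀ p ∈ W \ W', ∀ q ∈ W' \ W, candidateScore A q < candidateScore A p ∨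
        (candidateScore A q = candidateScore A p ∧ tie p < tie q) := fun p hp q hq =>
      h p (Finset.mem_sdiff.1 hp).1 q (Finset.mem_sdiff.1 hq).2
    -- The score of the best entering candidate `q₀`, times the number of exchanged candidates, lies
    -- between the two sums.
    obtain ⟨q₀, hq₀, hmax⟩ := Finset.exists_max_image (W' \ W) (candidateScore A) hpos
    have b1 : (W \ W').card • candidateScore A q₀ ≤ ∑ c ∈ W \ W', candidateScore A c :=
      Finset.card_nsmul_le_sum _ _ _ fun p hp => by
        rcases hpq p hp q₀ hq₀ with h | h
        · exact h.le
        · exact h.1.le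
    have b2 : ∑ c ∈ W' \ W, candidateScore A c ≤ (W' \ W).card • candidateScore A q₀ :=
      Finset.sum_le_card_nsmul _ _ _ hmax
    rw [hcard] at b1
    rcases (b2.trans b1).lt_or_eq with hlt | heq
    · left; linarith
    · right
      refine ⟨by linarith, ?_⟩
      -- Equality of the sums forces all exchanged candidates to have the same score, so every
      -- comparison is decided by the tie-breaking order and any leaving `p` is a witness.
      obtain ⟨p, hp⟩ := hpos'
      refine ⟨p, hp, fun q hq => ?_⟩
      have hq' : candidateScore A q = candidateScore A q₀ := by
        have := (Finset.sum_eq_sum_iff_of_le (s := W' \ W) (f := candidateScore A)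
          (g := fun _ => candidateScore A q₀) hmax).1 (by
            rw [Finset.sum_const]; exact le_antisymm b2 (b1.trans heq.ge))
        exact this q hq
      have hp' : candidateScore A q₀ = candidateScore A p := by
        have := (Finset.sum_eq_sum_iff_of_le (s := W \ W') (f := fun _ => candidateScore A q₀)
          (g := candidateScore A) fun p hp => by
            rcases hpq p hp q₀ hq₀ with h | h
            · exact h.le
            · exact h.1.le).1 (by
            rw [Finset.sum_const, hcard]; exact le_antisymm b1 (heq.ge.trans b2))
        exact this p hp
      rcases hpq p hp q hq with h | h
      · exact absurd (hq'.trans hp') h.ne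
      · exact h.2

/-- The low-order part `m - x` lies between 1 and `m`, so it never outweighs a difference of 1 in
the leading part; it decreases in `x` because early positions have priority. -/
theorem lex_key_lt_iff {m u v x y : ℕ} (hx : x < m) (hy : y < m) :
    u * m + (m - x) < v * m + (m - y) ↔ u < v ∨ (u = v ∧ y < x) := by
  rcases lt_trichotomy u v with h | h | h
  · have : (u + 1) * m ≤ v * m := Nat.mul_le_mul_right _ h
    rw [Nat.succ_mul] at this
    omega
  · subst h; omega
  · have : (v + 1) * m ≤ u * m := Nat.mul_le_mul_right _ h
    rw [Nat.succ_mul] at this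
    omega

/-! ### Two sets of given sizes under local constraints -/

-- By monotonicity the pairs allowed at `c` form an up-set or a down-set of {0,1}². The filters
-- count, in order of appearance, the candidates forced into B₁, admitted to B₁, forced into B₂ and
-- admitted to B₂, then those needing at least one of the two and those tolerating at most one. The
-- last two kinds link the sets: the former consume an extra place in a + b, the latter block one.
open Classical in
theorem exists_pair_of_card_iff {α : Type*} [Fintype α] [DecidableEq α] (ok : α → ℕ → ℕ → Prop) (a b : ℕ)
    (hok : ∀ c, (∀ x x' y y', x ≤ x' → y ≤ y' → ok c x y → ok c x' y') ∨
      (∀ x x' y y', x ≤ x' → y ≤ y' → ok c x' y' → ok c x y)) :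
    (∃ B₁ B₂ : Finset α, B₁.card = a ∧ B₂.card = b ∧
      ∀ c, ok c (if c ∈ B₁ then 1 else 0) (if c ∈ B₂ then 1 else 0)) ↔
    (∀ c, ok c 0 0 ∨ ok c 1 1) ∧
      (Finset.univ.filter fun c => ¬ ok c 0 0 ∧ ¬ ok c 0 1).card ≤ a ∧
      a ≤ (Finset.univ.filter fun c => ok c 1 0 ∨ ok c 1 1).card ∧
      (Finset.univ.filter fun c => ¬ ok c 0 0 ∧ ¬ ok c 1 0).card ≤ b ∧
      b ≤ (Finset.univ.filter fun c => ok c 0 1 ∨ ok c 1 1).card ∧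
      (Finset.univ.filter fun c => ¬ ok c 0 0 ∧ ¬ ok c 0 1).card +
          (Finset.univ.filter fun c => ¬ ok c 0 0 ∧ ¬ ok c 1 0).card +
          (Finset.univ.filter fun c => ¬ ok c 0 0 ∧ ok c 0 1 ∧ ok c 1 0).card ≤ a + b ∧
      a + b + (Finset.univ.filter fun c => ¬ ok c 1 1 ∧ ok c 0 1 ∧ ok c 1 0).card ≤
        (Finset.univ.filter fun c => ok c 1 0 ∨ ok c 1 1).card +
          (Finset.univ.filter fun c => ok c 0 1 ∨ ok c 1 1).card := by
  have up : ∀ c, (ok c 0 0 → ok c 0 1 ∧ ok c 1 0) ∧ (ok c 0 1 ∨ ok c 1 0 → ok c 1 1) ∨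
      (ok c 1 1 → ok c 0 1 ∧ ok c 1 0) ∧ (ok c 0 1 ∨ ok c 1 0 → ok c 0 0) := by
    intro c
    rcases hok c with h | h
    · left
      exact ⟨fun h0 => ⟨h 0 0 0 1 (by omega) (by omega) h0, h 0 1 0 0 (by omega) (by omega) h0⟩,
        fun h0 => h0.elim (h 0 1 1 1 (by omega) (by omega)) (h 1 1 0 1 (by omega) (by omega))⟩
    · right
      exact ⟨fun h0 => ⟨h 0 1 1 1 (by omega) (by omega) h0, h 1 1 0 1 (by omega) (by omega) h0⟩,
        fun h0 => h0.elim (h 0 0 0 1 (by omega) (by omega)) (h 0 1 0 0 (by omega) (by omega))⟩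
  obtain ⟨F₁, hF₁⟩ : ∃ F, F = Finset.univ.filter fun c => ¬ ok c 0 0 ∧ ¬ ok c 0 1 := ⟨_, rfl⟩
  obtain ⟨F₂, hF₂⟩ : ∃ F, F = Finset.univ.filter fun c => ¬ ok c 0 0 ∧ ¬ ok c 1 0 := ⟨_, rfl⟩
  obtain ⟨G₁, hG₁⟩ : ∃ F, F = Finset.univ.filter fun c => ok c 1 0 ∨ ok c 1 1 := ⟨_, rfl⟩
  obtain ⟨G₂, hG₂⟩ : ∃ F, F = Finset.univ.filter fun c => ok c 0 1 ∨ ok c 1 1 := ⟨_, rfl⟩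
  obtain ⟨E, hE⟩ : ∃ F, F = Finset.univ.filter fun c => ¬ ok c 0 0 ∧ ok c 0 1 ∧ ok c 1 0 :=
    ⟨_, rfl⟩
  obtain ⟨N, hN⟩ : ∃ F, F = Finset.univ.filter fun c => ¬ ok c 1 1 ∧ ok c 0 1 ∧ ok c 1 0 :=
    ⟨_, rfl⟩
  rw [← hF₁, ← hF₂, ← hG₁, ← hG₂, ← hE, ← hN]
  have mF₁ : ∀ c, c ∈ F₁ ↔ ¬ ok c 0 0 ∧ ¬ ok c 0 1 := by simp [hF₁]
  have mF₂ : ∀ c, c ∈ F₂ ↔ ¬ ok c 0 0 ∧ ¬ ok c 1 0 := by simp [hF₂]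
  have mG₁ : ∀ c, c ∈ G₁ ↔ ok c 1 0 ∨ ok c 1 1 := by simp [hG₁]
  have mG₂ : ∀ c, c ∈ G₂ ↔ ok c 0 1 ∨ ok c 1 1 := by simp [hG₂]
  have mE : ∀ c, c ∈ E ↔ ¬ ok c 0 0 ∧ ok c 0 1 ∧ ok c 1 0 := by simp [hE]
  have mN : ∀ c, c ∈ N ↔ ¬ ok c 1 1 ∧ ok c 0 1 ∧ ok c 1 0 := by simp [hN]
  clear hF₁ hF₂ hG₁ hG₂ hE hN
  have card_eq : ∀ S : Finset α, S.card = ∑ c, if c ∈ S then 1 else 0 := fun S => by simp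
  constructor
  · rintro ⟨B₁, B₂, rfl, rfl, h⟩
    refine ⟨fun c => ?_, Finset.card_le_card fun c hc => ?_, Finset.card_le_card fun c hc => ?_,
      Finset.card_le_card fun c hc => ?_, Finset.card_le_card fun c hc => ?_, ?_, ?_⟩
    · have := h c
      have := up c
      split_ifs at * <;> tauto
    · have := h c
      have := mF₁ c
      by_contra hn
      split_ifs at * <;> tauto
    · have := h c
      have := mG₁ c
      split_ifs at * <;> tauto
    · have := h c
      have := mF₂ c
      by_contra hn
      split_ifs at * <;> tauto
    · have := h c
      have := mG₂ c
      split_ifs at * <;> tauto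
    · rw [card_eq F₁, card_eq F₂, card_eq E, card_eq B₁, card_eq B₂, ← Finset.sum_add_distrib,
        ← Finset.sum_add_distrib, ← Finset.sum_add_distrib]
      refine Finset.sum_le_sum fun c _ => ?_
      have h1 := h c
      have h2 := mF₁ c
      have h3 := mF₂ c
      have h4 := mE c
      by_cases h5 : c ∈ B₁ <;> by_cases h6 : c ∈ B₂ <;> by_cases h7 : c ∈ F₁ <;>
        by_cases h8 : c ∈ F₂ <;> by_cases h9 : c ∈ E <;>
        simp only [h5, h6, h7, h8, h9, if_true, if_false] at * <;>
        first | omega | (exfalso; tauto)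
    · rw [card_eq G₁, card_eq G₂, card_eq N, card_eq B₁, card_eq B₂, ← Finset.sum_add_distrib,
        ← Finset.sum_add_distrib, ← Finset.sum_add_distrib]
      refine Finset.sum_le_sum fun c _ => ?_
      have h1 := h c
      have h2 := mG₁ c
      have h3 := mG₂ c
      have h4 := mN c
      by_cases h5 : c ∈ B₁ <;> by_cases h6 : c ∈ B₂ <;> by_cases h7 : c ∈ G₁ <;>
        by_cases h8 : c ∈ G₂ <;> by_cases h9 : c ∈ N <;>
        simp only [h5, h6, h7, h8, h9, if_true, if_false] at * <;>
        first | omega | (exfalso; tauto)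
  · rintro ⟨h0, h1, h2, h3, h4, h5, h6⟩
    -- `E₀` collects the candidates needing a ballot for which `B₂` has no room beside its forced
    -- members; they go to `B₁`.
    obtain ⟨E₀, hE₀, cE₀⟩ := Finset.exists_subset_card_eq
      (s := E) (n := F₂.card + E.card - b) (by omega)
    -- `B₂` can dispense with `G₂.card - b` admitted candidates, so that many elements of `N` may be
    -- opened to `B₁`; the others are reserved for `B₂`.
    obtain ⟨N₀, hN₀, cN₀⟩ := Finset.exists_subset_card_eq
      (s := N) (n := min N.card (G₂.card - b)) (by omega)
    have hNG : N ⊆ G₁ := fun c hc => by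
      have := mN c; have := mG₁ c; tauto
    have cU₁ : (G₁ \ (N \ N₀)).card = G₁.card - (N.card - N₀.card) := by
      rw [Finset.card_sdiff_of_subset (Finset.sdiff_subset.trans hNG),
        Finset.card_sdiff_of_subset hN₀]
    have cNG := Finset.card_le_card hNG
    have cL₁ : (F₁ ∪ E₀).card ≤ F₁.card + E₀.card := Finset.card_union_le _ _
    obtain ⟨B₁, hLB, hBU, cB₁⟩ := Finset.exists_subsuperset_card_eq
      (s := F₁ ∪ E₀) (t := G₁ \ (N \ N₀)) (n := a) (fun c hc => by
        have := mF₁ c; have := mE c; have := mG₁ c; have := mN c; have := up c; have := h0 c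
        have := @hE₀ c
        grind) (by omega) (by omega)
    have cEB : (E \ B₁).card ≤ E.card - E₀.card := by
      rw [← Finset.card_sdiff_of_subset hE₀]
      refine Finset.card_le_card (Finset.sdiff_subset_sdiff le_rfl ?_)
      exact Finset.subset_union_right.trans hLB
    have cNB : (N ∩ B₁).card ≤ N₀.card := Finset.card_le_card fun c hc => by
      have := @hBU c
      simp only [Finset.mem_inter, Finset.mem_sdiff] at *
      tauto
    have cL₂ : (F₂ ∪ (E \ B₁)).card ≤ F₂.card + (E \ B₁).card := Finset.card_union_le _ _
    have cU₂ : G₂.card - (N ∩ B₁).card ≤ (G₂ \ (N ∩ B₁)).card := Finset.le_card_sdiff _ _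
    have cE₀' := Finset.card_le_card hE₀
    -- Given `B₁`, the set `B₂` must take what `B₁` left of `E` and avoid what `B₁` took of `N`; the
    -- choices of `E₀` and `N₀` make both bounds compatible with `b`.
    obtain ⟨B₂, hLB₂, hBU₂, cB₂⟩ := Finset.exists_subsuperset_card_eq
      (s := F₂ ∪ (E \ B₁)) (t := G₂ \ (N ∩ B₁)) (n := b) (fun c hc => by
        have := mF₂ c; have := mE c; have := mG₂ c; have := mN c; have := up c; have := h0 c
        grind) (by omega) (by omega)
    refine ⟨B₁, B₂, cB₁, cB₂, fun c => ?_⟩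
    have := mF₁ c; have := mG₁ c; have := mF₂ c; have := mG₂ c; have := mE c; have := mN c
    have := up c; have := h0 c
    have := @hLB c; have := @hBU c; have := @hLB₂ c; have := @hBU₂ c
    simp only [Finset.mem_union, Finset.mem_sdiff, Finset.mem_inter] at *
    split_ifs <;> grind

/-! ### Integral scores -/

/-- The product of the numbers `1, …, m` apart from `j`, that is, `m! / j` for `1 ≤ j ≤ m`. -/
def sizeWeight (m j : ℕ) : ℕ :=
  ∏ i ∈ Finset.range (m + 1), if 1 ≤ i ∧ i ≠ j then i else 1

theorem sizeWeight_mul_self {m j : ℕ} (h1 : 1 ≤ j) (h2 : j ≤ m) :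
    sizeWeight m j * j = m.factorial := by
  have hj : ∏ i ∈ Finset.range (m + 1), (if i = j then i else 1) = j := by
    rw [Finset.prod_ite_eq' (Finset.range (m + 1)) j fun i => i, if_pos (by simp; omega)]
  calc sizeWeight m j * j
      = ∏ i ∈ Finset.range (m + 1), ((if 1 ≤ i ∧ i ≠ j then i else 1) *
          if i = j then i else 1) := by rw [Finset.prod_mul_distrib, hj, sizeWeight]
    _ = ∏ i ∈ Finset.range m, (i + 1) := by
        rw [Finset.prod_range_succ', if_neg (by omega), if_neg (by omega), mul_one, mul_one]
        refine Finset.prod_congr rfl fun i _ => ?_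
        split_ifs <;> omega
    _ = m.factorial := Finset.prod_range_add_one_eq_factorial m

/-- The score of a candidate, multiplied by `m!`. -/
def natScore {m n : ℕ} (A : Fin n → Finset (Fin m)) (c : Fin m) : ℕ :=
  ∑ i, if c ∈ A i then sizeWeight m (A i).card else 0

theorem natScore_eq {m n : ℕ} (A : Fin n → Finset (Fin m)) (c : Fin m) :
    (natScore A c : ℚ) = m.factorial * candidateScore A c := by
  rw [natScore, candidateScore, Finset.mul_sum, Nat.cast_sum]
  refine Finset.sum_congr rfl fun i _ => ?_
  split_ifs with h
  -- A ballot containing `c` is nonempty, so the value of `sizeWeight` at 0, which is no quotient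
  -- m!/j, never enters a score.
  · have h1 : 1 ≤ (A i).card := Finset.card_pos.2 ⟨c, h⟩
    have h2 : (A i).card ≤ m := by simpa using Finset.card_le_univ (A i)
    have h3 : ((A i).card : ℚ) ≠ 0 := by exact_mod_cast (by omega : (A i).card ≠ 0)
    rw [← sizeWeight_mul_self h1 h2]
    field_simp
    push_cast
    ring
  · simp

theorem natScore_append {m n : ℕ} (A : Fin n → Finset (Fin m)) (B : Fin 2 → Finset (Fin m))
    (c : Fin m) : natScore (Fin.append A B) c = natScore A c +
      (if c ∈ B 0 then 1 else 0) * sizeWeight m (B 0).card +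
      (if c ∈ B 1 then 1 else 0) * sizeWeight m (B 1).card := by
  simp only [natScore, Fin.sum_univ_add, Fin.append_left, Fin.append_right, Fin.sum_univ_two,
    ite_mul, one_mul, zero_mul, add_assoc]

namespace WSMInstance

/-- A number that orders the candidates as the rule does, when the additional ballots have the
sizes `a` and `b` and contain (`1`) or do not contain (`0`) the candidate according to `x`, `y`. -/
def key (I : WSMInstance) (a b x y : ℕ) (c : Fin I.m) : ℕ :=
  (natScore I.ballots c + x * sizeWeight I.m a + y * sizeWeight I.m b) * I.m + (I.m - I.tie c)

theorem key_mono (I : WSMInstance) (a b : ℕ) {x x' y y' : ℕ} (hx : x ≤ x') (hy : y ≤ y')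
    (c : Fin I.m) : I.key a b x y c ≤ I.key a b x' y' c := by
  unfold key
  gcongr

theorem sav_append_iff (I : WSMInstance) (B : Fin 2 → Finset (Fin I.m)) :
    SAV I.m (I.n + 2) (Fin.append I.ballots B) I.k I.tie I.P ↔ I.P.card = I.k ∧
      ∀ p ∈ I.P, ∀ q ∉ I.P,
        I.key (B 0).card (B 1).card (if q ∈ B 0 then 1 else 0) (if q ∈ B 1 then 1 else 0) q <
        I.key (B 0).card (B 1).card (if p ∈ B 0 then 1 else 0) (if p ∈ B 1 then 1 else 0) p := by
  rw [sav_iff]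
  refine and_congr_right fun _ => forall₂_congr fun p _ => forall₂_congr fun q _ => ?_
  have hm : (0 : ℚ) < I.m.factorial := by exact_mod_cast I.m.factorial_pos
  rw [key, key, lex_key_lt_iff (I.tie q).isLt (I.tie p).isLt, ← natScore_append,
    ← natScore_append, ← Nat.cast_lt (α := ℚ), ← Nat.cast_inj (R := ℚ), natScore_eq,
    natScore_eq, mul_lt_mul_iff_right₀ hm, mul_right_inj' hm.ne', Fin.lt_def]

/-- The threshold `θ` separates the candidate `c` correctly if it gets `x`, `y`. -/
def Meets (I : WSMInstance) (a b θ : ℕ) (c : Fin I.m) (x y : ℕ) : Prop :=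
  c ∈ I.P ↔ θ ≤ I.key a b x y c

open Classical in
/-- There are ballots of sizes `a` and `b` for which the threshold `θ` separates `P` from the other
candidates, in terms of counts of candidates. -/
def Feasible (I : WSMInstance) (a b θ : ℕ) : Prop :=
  (∀ c, I.Meets a b θ c 0 0 ∨ I.Meets a b θ c 1 1) ∧
    (Finset.univ.filter fun c => ¬ I.Meets a b θ c 0 0 ∧ ¬ I.Meets a b θ c 0 1).card ≤ a ∧
    a ≤ (Finset.univ.filter fun c => I.Meets a b θ c 1 0 ∨ I.Meets a b θ c 1 1).card ∧
    (Finset.univ.filter fun c => ¬ I.Meets a b θ c 0 0 ∧ ¬ I.Meets a b θ c 1 0).card ≤ b ∧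
    b ≤ (Finset.univ.filter fun c => I.Meets a b θ c 0 1 ∨ I.Meets a b θ c 1 1).card ∧
    (Finset.univ.filter fun c => ¬ I.Meets a b θ c 0 0 ∧ ¬ I.Meets a b θ c 0 1).card +
        (Finset.univ.filter fun c => ¬ I.Meets a b θ c 0 0 ∧ ¬ I.Meets a b θ c 1 0).card +
        (Finset.univ.filter fun c =>
          ¬ I.Meets a b θ c 0 0 ∧ I.Meets a b θ c 0 1 ∧ I.Meets a b θ c 1 0).card ≤ a + b ∧
    a + b + (Finset.univ.filter fun c =>
        ¬ I.Meets a b θ c 1 1 ∧ I.Meets a b θ c 0 1 ∧ I.Meets a b θ c 1 0).card ≤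
      (Finset.univ.filter fun c => I.Meets a b θ c 1 0 ∨ I.Meets a b θ c 1 1).card +
        (Finset.univ.filter fun c => I.Meets a b θ c 0 1 ∨ I.Meets a b θ c 1 1).card

theorem feasible_iff (I : WSMInstance) (a b θ : ℕ) : I.Feasible a b θ ↔
    ∃ B₁ B₂ : Finset (Fin I.m), B₁.card = a ∧ B₂.card = b ∧
      ∀ c, I.Meets a b θ c (if c ∈ B₁ then 1 else 0) (if c ∈ B₂ then 1 else 0) := by
  have := exists_pair_of_card_iff (I.Meets a b θ) a b fun c => by
    by_cases hc : c ∈ I.P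
    · left
      intro x x' y y' hx hy h
      simp only [Meets, hc, true_iff] at h ⊢
      exact h.trans (I.key_mono a b hx hy c)
    · right
      intro x x' y y' hx hy h
      simp only [Meets, hc, false_iff, not_le] at h ⊢
      exact (I.key_mono a b hx hy c).trans_lt h
  unfold Feasible
  rw [← this]

/-- The guess ranges over ballot sizes and over the member `t` of least key with its two bits. An
empty `P` has no such member, but then nothing needs to be beaten. -/
theorem winningSetManipulation_sav_iff (I : WSMInstance) :
    WinningSetManipulation SAV 2 I ↔ I.P.card = I.k ∧ (I.P.card = 0 ∨
      ∃ a b : Fin (I.m + 1), ∃ t, t ∈ I.P ∧ ∃ x y : Fin 2,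
        I.Feasible a b (I.key a b x y t)) := by
  simp only [WinningSetManipulation, sav_append_iff]
  constructor
  · rintro ⟨B, hk, h⟩
    refine ⟨hk, ?_⟩
    rcases I.P.eq_empty_or_nonempty with h0 | h0
    · left; rw [h0, Finset.card_empty]
    right
    obtain ⟨t, ht, hmin⟩ := Finset.exists_min_image I.P (fun p => I.key (B 0).card (B 1).card
      (if p ∈ B 0 then 1 else 0) (if p ∈ B 1 then 1 else 0) p) h0
    have hcard : ∀ S : Finset (Fin I.m), S.card < I.m + 1 := fun S => by
      simpa [Nat.lt_succ_iff] using Finset.card_le_univ S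
    have hv : ∀ S : Finset (Fin I.m), ((if t ∈ S then (1 : Fin 2) else 0 : Fin 2) : ℕ) =
        if t ∈ S then 1 else 0 := fun S => by split_ifs <;> rfl
    refine ⟨⟨_, hcard (B 0)⟩, ⟨_, hcard (B 1)⟩, t, ht, if t ∈ B 0 then 1 else 0,
      if t ∈ B 1 then 1 else 0, ?_⟩
    rw [feasible_iff, hv, hv]
    refine ⟨B 0, B 1, rfl, rfl, fun c => ?_⟩
    by_cases hc : c ∈ I.P
    · simpa only [Meets, hc, true_iff] using hmin c hc
    · simpa only [Meets, hc, false_iff, not_le] using h t ht c hc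
  · rintro ⟨hk, h⟩
    -- Any separating threshold proves the claim: neither `t ∈ P` nor agreement of the guessed bits
    -- with the ballots found is needed.
    rcases h with h | ⟨a, b, t, -, x, y, h⟩
    · rw [Finset.card_eq_zero] at h
      exact ⟨fun _ => ∅, hk, fun p hp => by simp [h] at hp⟩
    · obtain ⟨B₁, B₂, ha, hb, hB⟩ := (I.feasible_iff _ _ _).1 h
      refine ⟨![B₁, B₂], hk, fun p hp q hq => ?_⟩
      have h1 := hB p
      have h2 := hB q
      simp only [Meets, hp, hq, true_iff, false_iff, not_le] at h1 h2
      change I.key B₁.card B₂.card (if q ∈ B₁ then 1 else 0) (if q ∈ B₂ then 1 else 0) q <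
        I.key B₁.card B₂.card (if p ∈ B₁ then 1 else 0) (if p ∈ B₂ then 1 else 0) p
      rw [ha, hb]
      exact h2.trans_le h1

end WSMInstance

/-! ### The input list -/

theorem getD_indicatorList {m : ℕ} (S : Finset (Fin m)) (c : Fin m) :
    (indicatorList S).getD c 0 = if c ∈ S then 1 else 0 := by
  rw [indicatorList, List.getD_eq_getElem _ _ (by simp)]
  simp

theorem getD_flatten_of_length_eq {L : List (List ℕ)} {m : ℕ} (hL : ∀ a ∈ L, a.length = m)
    (i : ℕ) {c : ℕ} (hc : c < m) : L.flatten.getD (i * m + c) 0 = (L.getD i []).getD c 0 := by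
  induction L generalizing i with
  | nil => simp
  | cons a L ih =>
    have ha := hL a (by simp)
    cases i with
    | zero =>
      rw [List.flatten_cons, List.getD_append _ _ _ _ (by omega)]
      simp
    | succ i =>
      rw [List.flatten_cons, List.getD_append_right _ _ _ _ (by rw [ha, Nat.succ_mul]; omega), ha,
        List.getD_cons_succ, ← ih (fun b hb => hL b (by simp [hb]))]
      congr 1
      rw [Nat.succ_mul]
      omega

namespace WSMInstance

theorem length_encode (I : WSMInstance) :
    I.encode.length = 3 + 2 * I.m + I.n * I.m := by
  have : ∀ j, (indicatorList (I.ballots j)).length = I.m := fun j => by simp [indicatorList]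
  simp only [encode, List.length_append, List.length_flatten, List.map_ofFn, List.length_ofFn,
    List.sum_ofFn, Function.comp_def, this]
  simp [indicatorList]
  ring

/-- The offset 4 skips the length in register 0 and the three numbers m, n, k. -/
theorem ramInput_P (I : WSMInstance) (c : Fin I.m) :
    ramInput I.encode (4 + c) = if c ∈ I.P then 1 else 0 := by
  rw [← getD_indicatorList, show 4 + (c : ℕ) = (3 + c) + 1 by omega, ramInput,
    List.getD_cons_succ, encode, List.append_assoc, List.append_assoc,
    List.getD_append_right _ _ _ _ (by simp), List.getD_append _ _ _ _ (by simp [indicatorList])]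
  simp

theorem ramInput_tie (I : WSMInstance) (c : Fin I.m) :
    ramInput I.encode (4 + I.m + c) = I.tie c := by
  rw [show 4 + I.m + (c : ℕ) = (3 + I.m + c) + 1 by omega, ramInput,
    List.getD_cons_succ, encode, List.append_assoc,
    List.getD_append_right _ _ _ _ (by simp [indicatorList]; omega),
    List.getD_append _ _ _ _ (by simp [indicatorList]; omega),
    List.getD_eq_getElem _ _ (by simp [indicatorList]; omega), List.getElem_ofFn]
  congr 2
  ext
  simp [indicatorList]
  omega

theorem ramInput_ballots (I : WSMInstance) (i : Fin I.n) (c : Fin I.m) :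
    ramInput I.encode (4 + 2 * I.m + i * I.m + c) = if c ∈ I.ballots i then 1 else 0 := by
  rw [← getD_indicatorList,
    show 4 + 2 * I.m + i * I.m + (c : ℕ) = (3 + 2 * I.m + (i * I.m + c)) + 1 by omega, ramInput,
    List.getD_cons_succ, encode,
    List.getD_append_right _ _ _ _ (by simp [indicatorList]; omega)]
  have hl : 3 + 2 * I.m + (i * I.m + c) - ([I.m, I.n, I.k] ++ indicatorList I.P ++
      List.ofFn fun c : Fin I.m => (I.tie c : ℕ)).length = i * I.m + c := by
    simp [indicatorList]
    omega
  rw [hl, getD_flatten_of_length_eq _ _ c.isLt]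
  · congr 1
    rw [List.getD_eq_getElem _ _ (by simp)]
    simp
  · simp only [List.mem_ofFn, forall_exists_index]
    rintro _ j rfl
    simp [indicatorList]

end WSMInstance

/-! ### Terms for the connectives and for bounded quantifiers -/

namespace BTerm

/-- The term has the truth value of the proposition. -/
def Decides (t : BTerm) (l : List ℕ) (ρ : ℕ → ℕ) (p : Prop) : Prop :=
  (p → t.eval l ρ = 1) ∧ (¬ p → t.eval l ρ = 0)

/-- The sum of two terms. -/
def add (s t : BTerm) : BTerm := bin .add s t

/-- The product of two terms. -/
def mul (s t : BTerm) : BTerm := bin .mul s t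

/-- The truncated difference of two terms. -/
def sub (s t : BTerm) : BTerm := bin .sub s t

/-- Negation. -/
def not (t : BTerm) : BTerm := sub (lit 1) t

/-- Disjunction. -/
def or (s t : BTerm) : BTerm := not (mul (not s) (not t))

/-- The comparison `s ≤ t`. -/
def le (s t : BTerm) : BTerm := not (sub s t)

/-- The equality `s = t`, and the equivalence of truth values. -/
def eq (s t : BTerm) : BTerm := mul (le s t) (le t s)

/-- The value of `s` or of `t`, depending on the truth value of `q`. -/
def cond (q s t : BTerm) : BTerm := add (mul q s) (mul (not q) t)

/-- The sum of `t` over all values of `x` below `b`. -/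
def sumBelow (x : ℕ) (b t : BTerm) : BTerm :=
  big .add 0 x (cond (le (add (var x) (lit 1)) b) t (lit 0))

/-- The product of `t` over all values of `x` below `b`. -/
def prodBelow (x : ℕ) (b t : BTerm) : BTerm :=
  big .mul 1 x (cond (le (add (var x) (lit 1)) b) t (lit 1))

/-- Existence of a value of `x` below `b`. -/
def ex (x : ℕ) (b t : BTerm) : BTerm := le (lit 1) (sumBelow x b t)

/-- Universal quantification over the values of `x` below `b`. -/
def all (x : ℕ) (b t : BTerm) : BTerm := not (ex x b (not t))

variable {l : List ℕ} {ρ : ℕ → ℕ} {s t : BTerm} {p q : Prop}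

@[simp] theorem eval_lit (n : ℕ) : (lit n).eval l ρ = n := rfl

@[simp] theorem eval_var (x : ℕ) : (var x).eval l ρ = ρ x := rfl

@[simp] theorem eval_input : (input t).eval l ρ = ramInput l (t.eval l ρ) := rfl

@[simp] theorem eval_add : (add s t).eval l ρ = s.eval l ρ + t.eval l ρ := rfl

@[simp] theorem eval_mul : (mul s t).eval l ρ = s.eval l ρ * t.eval l ρ := rfl

@[simp] theorem eval_sub : (sub s t).eval l ρ = s.eval l ρ - t.eval l ρ := rfl

theorem Decides.not (h : t.Decides l ρ p) : (BTerm.not t).Decides l ρ (¬ p) := by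
  constructor
  · intro hp; simp [BTerm.not, h.2 hp]
  · intro hp; simp [BTerm.not, h.1 (not_not.1 hp)]

theorem Decides.and (hs : s.Decides l ρ p) (ht : t.Decides l ρ q) :
    (mul s t).Decides l ρ (p ∧ q) := by
  constructor
  · rintro ⟨hp, hq⟩; simp [hs.1 hp, ht.1 hq]
  · intro h
    by_cases hp : p
    · simp [ht.2 fun hq => h ⟨hp, hq⟩]
    · simp [hs.2 hp]

theorem Decides.or (hs : s.Decides l ρ p) (ht : t.Decides l ρ q) :
    (BTerm.or s t).Decides l ρ (p ∨ q) := by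
  have := (hs.not.and ht.not).not
  rwa [← not_or, not_not] at this

theorem decides_le : (le s t).Decides l ρ (s.eval l ρ ≤ t.eval l ρ) := by
  constructor <;> intro h <;> simp only [le, BTerm.not, eval_sub, eval_lit] <;> omega

theorem decides_eq : (eq s t).Decides l ρ (s.eval l ρ = t.eval l ρ) := by
  rw [le_antisymm_iff]
  exact decides_le.and decides_le

theorem Decides.iff (hs : s.Decides l ρ p) (ht : t.Decides l ρ q) :
    (eq s t).Decides l ρ (p ↔ q) := by
  have h : (p ↔ q) ↔ s.eval l ρ = t.eval l ρ := by
    by_cases hp : p <;> by_cases hq : q <;> simp [hp, hq, hs.1, hs.2, ht.1, ht.2]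
  rw [h]
  exact decides_eq

open Classical in
theorem Decides.eval_eq (h : t.Decides l ρ p) : t.eval l ρ = if p then 1 else 0 := by
  split_ifs with hp
  · exact h.1 hp
  · exact h.2 hp

open Classical in
theorem Decides.eval_cond {r : BTerm} (h : r.Decides l ρ p) :
    (cond r s t).eval l ρ = if p then s.eval l ρ else t.eval l ρ := by
  simp only [cond, eval_add, eval_mul, h.eval_eq, h.not.eval_eq]
  split_ifs <;> simp_all

theorem decides_of_eval_eq [Decidable p] (h : t.eval l ρ = if p then 1 else 0) :
    t.Decides l ρ p :=
  ⟨fun hp => by rw [h, if_pos hp], fun hp => by rw [h, if_neg hp]⟩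

/-- The underlying fold always runs over the whole input length; the guard replaces the summands
from `N` on by the neutral element, which is why `N` may not exceed that length. -/
theorem eval_sumBelow {x N : ℕ} {b : BTerm} {f : Fin N → ℕ}
    (hb : ∀ i, b.eval l (Function.update ρ x i) = N) (hN : N ≤ l.length)
    (hf : ∀ i : Fin N, t.eval l (Function.update ρ x i) = f i) :
    (sumBelow x b t).eval l ρ = ∑ i, f i := by
  simp only [sumBelow, eval, ArithOp.fold_add, decides_le.eval_cond]
  simp only [eval_add, eval_var, eval_lit, hb, Function.update_self]
  rw [← Finset.sum_filter, ← Finset.sum_congr rfl fun i _ => hf i,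
    ← Finset.sum_range fun i => t.eval l (Function.update ρ x i)]
  refine Finset.sum_congr ?_ fun _ _ => rfl
  ext i
  simp
  omega

theorem eval_prodBelow {x N : ℕ} {b : BTerm} {f : ℕ → ℕ}
    (hb : ∀ i, b.eval l (Function.update ρ x i) = N) (hN : N ≤ l.length)
    (hf : ∀ i, t.eval l (Function.update ρ x i) = f i) :
    (prodBelow x b t).eval l ρ = ∏ i ∈ Finset.range N, f i := by
  simp only [prodBelow, eval, ArithOp.fold_mul, decides_le.eval_cond]
  simp only [eval_add, eval_var, eval_lit, hb, Function.update_self, hf]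
  rw [← Finset.prod_filter]
  refine Finset.prod_congr ?_ fun _ _ => rfl
  ext i
  simp
  omega

theorem eval_count {x N : ℕ} {b : BTerm} {P : Fin N → Prop} [DecidablePred P]
    (hb : ∀ i, b.eval l (Function.update ρ x i) = N) (hN : N ≤ l.length)
    (hP : ∀ i : Fin N, t.Decides l (Function.update ρ x i) (P i)) :
    (sumBelow x b t).eval l ρ = (Finset.univ.filter P).card := by
  rw [eval_sumBelow hb hN fun i => (hP i).eval_eq, Finset.card_filter]
  congr!

theorem decides_ex {x N : ℕ} {b : BTerm} {P : Fin N → Prop}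
    (hb : ∀ i, b.eval l (Function.update ρ x i) = N) (hN : N ≤ l.length)
    (hP : ∀ i : Fin N, t.Decides l (Function.update ρ x i) (P i)) :
    (ex x b t).Decides l ρ (∃ i, P i) := by
  classical
  have h : (∃ i, P i) ↔ (lit 1).eval l ρ ≤ (sumBelow x b t).eval l ρ := by
    rw [eval_count hb hN hP, eval_lit, Nat.one_le_iff_ne_zero, Finset.card_ne_zero,
      Finset.filter_nonempty_iff]
    simp
  rw [h]
  exact decides_le

theorem decides_all {x N : ℕ} {b : BTerm} {P : Fin N → Prop}
    (hb : ∀ i, b.eval l (Function.update ρ x i) = N) (hN : N ≤ l.length)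
    (hP : ∀ i : Fin N, t.Decides l (Function.update ρ x i) (P i)) :
    (all x b t).Decides l ρ (∀ i, P i) := by
  have := (decides_ex hb hN fun i => (hP i).not).not
  rwa [← not_forall, not_not] at this

end BTerm

/-! ### The decision procedure -/

namespace BTerm

/-- The number of candidates. -/
def numCandidates : BTerm := input (lit 1)

/-- Membership of the candidate `x` in the preferred set. -/
def preferred (x : ℕ) : BTerm := input (add (lit 4) (var x))

/-- The position of the candidate `x` in the tie-breaking order. -/
def position (x : ℕ) : BTerm := input (add (add (lit 4) numCandidates) (var x))

/-- Membership of the candidate `x` in the ballot with the number kept in the variable `6`. -/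
def ballot (x : ℕ) : BTerm :=
  input (add (add (add (lit 4) (mul (lit 2) numCandidates)) (mul (var 6) numCandidates)) (var x))

/-- The size of the ballot with the number kept in the variable `6`. -/
def ballotSize : BTerm := sumBelow 7 numCandidates (ballot 7)

/-- The weight `m! / t` of a vote on a ballot of size `t`. -/
def weight (t : BTerm) : BTerm :=
  prodBelow 8 (add numCandidates (lit 1))
    (cond (mul (le (lit 1) (var 8)) (not (eq (var 8) t))) (var 8) (lit 1))

/-- The integral score of the candidate `x`. -/
def score (x : ℕ) : BTerm :=
  sumBelow 6 (input (lit 2)) (cond (ballot x) (weight ballotSize) (lit 0))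

/-- The key of the candidate `x` if it gets `s` and `t` from ballots whose sizes are kept in the
variables `0` and `1`. -/
def keyTerm (x : ℕ) (s t : BTerm) : BTerm :=
  add (mul (add (add (score x) (mul s (weight (var 0)))) (mul t (weight (var 1)))) numCandidates)
    (sub numCandidates (position x))

/-- The candidate in variable `5` is separated by the threshold that belongs to the candidate in
variable `2` and the bits in the variables `3` and `4`. -/
def meets (x y : ℕ) : BTerm :=
  eq (preferred 5) (le (keyTerm 2 (var 3) (var 4)) (keyTerm 5 (lit x) (lit y)))

/-- The number of candidates, as values of variable `5`, with the property `t`. -/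
def count (t : BTerm) : BTerm := sumBelow 5 numCandidates t

/-- The term for `WSMInstance.Feasible`. -/
def feasible : BTerm :=
  mul (all 5 numCandidates (or (meets 0 0) (meets 1 1)))
  (mul (le (count (mul (not (meets 0 0)) (not (meets 0 1)))) (var 0))
  (mul (le (var 0) (count (or (meets 1 0) (meets 1 1))))
  (mul (le (count (mul (not (meets 0 0)) (not (meets 1 0)))) (var 1))
  (mul (le (var 1) (count (or (meets 0 1) (meets 1 1))))
  (mul (le (add (add (count (mul (not (meets 0 0)) (not (meets 0 1))))
      (count (mul (not (meets 0 0)) (not (meets 1 0)))))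
      (count (mul (not (meets 0 0)) (mul (meets 0 1) (meets 1 0))))) (add (var 0) (var 1)))
  (le (add (add (var 0) (var 1)) (count (mul (not (meets 1 1)) (mul (meets 0 1) (meets 1 0)))))
    (add (count (or (meets 1 0) (meets 1 1))) (count (or (meets 0 1) (meets 1 1))))))))))

/-- The term that decides Winning Set Manipulation for two agents. -/
def savManipulation : BTerm :=
  mul (eq (count (preferred 5)) (input (lit 3)))
    (or (eq (count (preferred 5)) (lit 0))
      (ex 0 (add numCandidates (lit 1)) (ex 1 (add numCandidates (lit 1))
        (ex 2 numCandidates (mul (preferred 2) (ex 3 (lit 2) (ex 4 (lit 2) feasible)))))))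

end BTerm

namespace WSMInstance

open BTerm

variable (I : WSMInstance) {ρ : ℕ → ℕ}

theorem m_succ_le_length : I.m + 1 ≤ I.encode.length := by
  rw [length_encode]
  omega

theorem m_le_length : I.m ≤ I.encode.length := by
  rw [length_encode]
  omega

theorem eval_numCandidates : numCandidates.eval I.encode ρ = I.m := rfl

theorem decides_preferred {x : ℕ} {c : Fin I.m} (h : ρ x = c) :
    (preferred x).Decides I.encode ρ (c ∈ I.P) :=
  decides_of_eval_eq (by simp only [preferred, eval_input, eval_add, eval_lit, eval_var, h,
    ramInput_P])

theorem eval_position {x : ℕ} {c : Fin I.m} (h : ρ x = c) :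
    (position x).eval I.encode ρ = I.tie c := by
  simp only [position, eval_input, eval_add, eval_lit, eval_var, h, eval_numCandidates,
    ramInput_tie]

theorem decides_ballot {x : ℕ} {i : Fin I.n} {c : Fin I.m} (hi : ρ 6 = i) (h : ρ x = c) :
    (ballot x).Decides I.encode ρ (c ∈ I.ballots i) :=
  decides_of_eval_eq (by simp only [ballot, eval_input, eval_add, eval_mul, eval_lit, eval_var, h,
    hi, eval_numCandidates, ramInput_ballots])

theorem eval_ballotSize {i : Fin I.n} (hi : ρ 6 = i) :
    ballotSize.eval I.encode ρ = (I.ballots i).card := by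
  rw [ballotSize, eval_count (P := fun c => c ∈ I.ballots i) (fun _ => rfl) I.m_le_length
    fun c => I.decides_ballot (by simp [hi]) (by simp)]
  simp

theorem eval_weight {t : BTerm} {j : ℕ}
    (h : ∀ i, t.eval I.encode (Function.update ρ 8 i) = j) :
    (weight t).eval I.encode ρ = sizeWeight I.m j := by
  rw [weight, sizeWeight]
  refine eval_prodBelow (N := I.m + 1) (fun _ => rfl) I.m_succ_le_length fun i => ?_
  rw [(decides_le.and decides_eq.not).eval_cond]
  simp only [eval_lit, eval_var, Function.update_self, h, ne_eq]

theorem eval_score {x : ℕ} {c : Fin I.m} (h : ρ x = c) (h6 : x ≠ 6) :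
    (score x).eval I.encode ρ = natScore I.ballots c := by
  have hn : I.n ≤ I.encode.length := by
    rw [length_encode]
    -- The existence of `c` gives m ≥ 1, hence n ≤ n·m. Without candidates the encoding would be too
    -- short to range over the ballots.
    have := Nat.mul_le_mul_left I.n (Nat.one_le_of_lt c.isLt)
    omega
  refine eval_sumBelow (fun _ => rfl) hn fun i => ?_
  rw [(I.decides_ballot (i := i) (c := c) (by simp) (by simp [h6, h])).eval_cond,
    I.eval_weight (j := (I.ballots i).card) fun k => I.eval_ballotSize (by simp), eval_lit]
  congr

theorem eval_keyTerm {x u v : ℕ} {s t : BTerm} {c : Fin I.m} (h : ρ x = c) (h6 : x ≠ 6)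
    (hs : s.eval I.encode ρ = u) (ht : t.eval I.encode ρ = v) :
    (keyTerm x s t).eval I.encode ρ = I.key (ρ 0) (ρ 1) u v c := by
  simp only [keyTerm, key, eval_add, eval_mul, eval_sub, I.eval_score h h6, hs, ht,
    eval_numCandidates, I.eval_position h,
    I.eval_weight (ρ := ρ) (t := var 0) (j := ρ 0) (by simp),
    I.eval_weight (ρ := ρ) (t := var 1) (j := ρ 1) (by simp)]

theorem decides_meets {c t : Fin I.m} (hc : ρ 5 = c) (ht : ρ 2 = t) (x y : ℕ) :
    (meets x y).Decides I.encode ρ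
      (I.Meets (ρ 0) (ρ 1) (I.key (ρ 0) (ρ 1) (ρ 3) (ρ 4) t) c x y) := by
  have h := (I.decides_preferred hc).iff (decides_le (l := I.encode) (ρ := ρ)
    (s := keyTerm 2 (var 3) (var 4)) (t := keyTerm 5 (lit x) (lit y)))
  rwa [I.eval_keyTerm (u := ρ 3) (v := ρ 4) ht (by norm_num) rfl rfl,
    I.eval_keyTerm (u := x) (v := y) hc (by norm_num) rfl rfl] at h

theorem eval_count {t : BTerm} {P : Fin I.m → Prop} [DecidablePred P]
    (h : ∀ c : Fin I.m, t.Decides I.encode (Function.update ρ 5 c) (P c)) :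
    (count t).eval I.encode ρ = (Finset.univ.filter P).card :=
  BTerm.eval_count (fun _ => rfl) I.m_le_length h

theorem decides_feasible {t : Fin I.m} (ht : ρ 2 = t) :
    feasible.Decides I.encode ρ
      (I.Feasible (ρ 0) (ρ 1) (I.key (ρ 0) (ρ 1) (ρ 3) (ρ 4) t)) := by
  classical
  have M : ∀ (x y : ℕ) (c : Fin I.m), (meets x y).Decides I.encode (Function.update ρ 5 c)
      (I.Meets (ρ 0) (ρ 1) (I.key (ρ 0) (ρ 1) (ρ 3) (ρ 4) t) c x y) := fun x y c => by
    simpa using I.decides_meets (ρ := Function.update ρ 5 c) (c := c) (t := t) (by simp)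
      (by simpa using ht) x y
  have c₁ := I.eval_count fun c => (M 0 0 c).not.and (M 0 1 c).not
  have c₂ := I.eval_count fun c => (M 1 0 c).or (M 1 1 c)
  have c₃ := I.eval_count fun c => (M 0 0 c).not.and (M 1 0 c).not
  have c₄ := I.eval_count fun c => (M 0 1 c).or (M 1 1 c)
  have c₅ := I.eval_count fun c => (M 0 0 c).not.and ((M 0 1 c).and (M 1 0 c))
  have c₆ := I.eval_count fun c => (M 1 1 c).not.and ((M 0 1 c).and (M 1 0 c))
  unfold Feasible
  -- With cardinalities replaced by values of counting terms, each inequality is an instance of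
  -- `decides_le`.
  rw [← c₁, ← c₂, ← c₃, ← c₄, ← c₅, ← c₆]
  exact (decides_all (fun _ => rfl) I.m_le_length fun c => (M 0 0 c).or (M 1 1 c)).and
    (decides_le.and (decides_le.and (decides_le.and (decides_le.and
      (decides_le.and decides_le)))))

theorem decides_savManipulation :
    savManipulation.Decides I.encode 0 (WinningSetManipulation SAV 2 I) := by
  classical
  have hc : (count (preferred 5)).eval I.encode 0 = I.P.card := by
    rw [I.eval_count (P := fun c => c ∈ I.P) fun c => I.decides_preferred (by simp)]
    simp
  have h2 : 2 ≤ I.encode.length := by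
    rw [length_encode]
    omega
  rw [winningSetManipulation_sav_iff, ← hc]
  refine Decides.and decides_eq (Decides.or decides_eq ?_)
  refine decides_ex (fun _ => rfl) I.m_succ_le_length fun a => ?_
  refine decides_ex (fun _ => rfl) I.m_succ_le_length fun b => ?_
  refine decides_ex (fun _ => rfl) I.m_le_length fun t => ?_
  refine (I.decides_preferred (by simp)).and ?_
  refine decides_ex (fun _ => rfl) h2 fun x => ?_
  refine decides_ex (fun _ => rfl) h2 fun y => ?_
  exact I.decides_feasible (t := t) (by simp)

end WSMInstance

theorem mainTheorem8 :
    PolyTimeDecidable WSMInstance.encode (WinningSetManipulation SAV 2) :=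
  polyTimeDecidable_of_term BTerm.savManipulation (fun I => I.decides_savManipulation.1)
    fun I => I.decides_savManipulation.2
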